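/- A group $G$ has the Magnus property if any two elements $u,v\in G$ with the same normal closure in $G$ satisfy that $u$ is conjugate in $G$ to $v$ or to $v^{-1}$. A limit group is a finitely generated group $L$ that is fully residually free: for every finite subset $S\subseteq L$ there is a homomorphism from $L$ to a free group that is injective on $S$. Let $C$ be an arbitrary group. Then the following statements are equivalent. (i) The direct product $L\times C$ has the Magnus property for some nontrivial limit group $L$ with the Magnus property. (ii) For every index set $\mathcal I\subseteq\mathbb N$ and all limit groups $L_i$ ($i\in\mathcal I$) with the Magnus property, the group $\big(\bigtimes_{i\in\mathcal I}L_i\big)\times C$ has the Magnus property. Here $\bigtimes_{i\in\mathcal I}L_i$ may be read either as the restricted direct product (families with only finitely many nontrivial components) or as the unrestricted direct product (all families): (i) is equivalent to (ii) under each of the two readings. -/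

import Mathlib

open scoped RestrictedProduct

universe u v w

/-- A group has the *Magnus property* if any two elements with the same normal closure are
conjugate up to inversion. -/
def HasMagnusProperty (G : Type*) [Group G] : Prop :=
  ∀ u v : G, Subgroup.normalClosure {u} = Subgroup.normalClosure {v} →
    IsConj u v ∨ IsConj u v⁻¹

/-- A *limit group*: a finitely generated, fully residually free group, i.e. every finite subset
is mapped injectively by some homomorphism to a free group. (Since `L` is finitely generated the
free group may be taken of finite rank, so letting its basis range over `Type` loses nothing.
With this definition the trivial group is a limit group.) -/
structure IsLimitGroup (L : Type*) [Group L] : Prop where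
  fg : Group.FG L
  fullyResiduallyFree : ∀ S : Finset L, ∃ (α : Type) (f : L →* FreeGroup α),
    Set.InjOn f (S : Set L)

/-- The restricted direct product (direct sum) of a family of groups: the families with only
finitely many nontrivial components, with componentwise multiplication. -/
abbrev RestrictedDirectProduct {ι : Type*} (G : ι → Type*) [∀ i, Group (G i)] : Type _ :=
  Πʳ i, [G i, (⊥ : Subgroup (G i))]

/-!
For an element `a` of a group `G` write `⟪a⟫` for its normal closure and `D(a) = ⁅⟪a⟫, G⁆`. The
quotient `⟪a⟫ / D(a)` is cyclic, generated by the image of `a`, and conjugate elements of `⟪a⟫`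
agree in it. So an element `b` of `⟪a⟫` is congruent to some power `a ^ k`
(`exists_zpow_neg_mul_mem_commutator`), and if `b` is conjugate to `a ^ e`, then
`a ^ (e - k) ∈ D(a)` (`IsConj.zpow_sub_mem_commutator`).

In a nontrivial limit group the order of `a ≠ 1` modulo `D(a)` is infinite
(`IsLimitGroup.eq_zero_of_zpow_mem_commutator`). By residual freeness it suffices to see this in a
free group (`FreeGroup.eq_one_of_pow_mem_commutator`), where it follows from the Magnus
representation `x ↦ 1 + X` on power series in noncommuting variables. The relation `X ^ 2 = 0` may
be imposed: the product over the syllables `x ^ n` of a reduced word is then a product of factors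
`1 + n X`, whose leading monomial has the nonzero coefficient `∏ n`, so the representation stays
faithful. Filtering by degree gives a descending series of normal subgroups with trivial
intersection and torsion-free central factors. If `a` lies in one term of the series and
`a ^ n ∈ D(a)` with `n ≠ 0`, then `a ^ n`, and hence `a`, lies in the next term; so `a = 1`.

Consequently, in a limit group with the Magnus property the exponent `±1` in the conjugacy between
`b` and `a ^ (±1)` is the exponent `k` above, which is determined by `a` and `b`
(`HasDetectingMagnusProperty`). In a direct product, restricted or not, a single `k` serves all
coordinates, so this property passes to direct products.

If `X ≠ 1` has this property, then `X × C` has the Magnus property if and only if `C` has it and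
every `c : C` with `c ^ 2 ∈ D(c)` is conjugate to its inverse (`IsMagnusComplement`). Indeed, if
`c ^ 2 ∈ D(c)`, then `(l, c)` and `(l, c⁻¹)` have the same normal closure for each `l : X`, while
no `l ≠ 1` is conjugate to its inverse; conversely the exponents in `X` and in `C` can only disagree
when `c ^ 2 ∈ D(c)`. This criterion does not involve `X`, which is why one nontrivial limit group
decides about all of them; the infinite cyclic group provides a nontrivial limit group with the
Magnus property.
-/

open scoped commutatorElement

/-! ### The central quotient of a normal closure -/

/-- For `v` in the normal closure `N` of `u`, the quotient `N / ⁅N, G⁆` is generated by `u`. -/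
theorem exists_zpow_neg_mul_mem_commutator {G : Type*} [Group G] {u v : G}
    (h : v ∈ Subgroup.normalClosure {u}) :
    ∃ k : ℤ, u ^ (-k) * v ∈ ⁅Subgroup.normalClosure {u}, (⊤ : Subgroup G)⁆ := by
  set N := Subgroup.normalClosure {u}
  have hu : u ∈ N := Subgroup.subset_normalClosure rfl
  -- `⟨u⟩ ⁅N, G⁆` is normal since conjugation acts trivially on `N / ⁅N, G⁆`.
  have hle : Subgroup.zpowers u ⊔ ⁅N, (⊤ : Subgroup G)⁆ ≤ N :=
    sup_le (by simpa using hu) (Subgroup.commutator_le_left N ⊤)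
  have hnormal : (Subgroup.zpowers u ⊔ ⁅N, (⊤ : Subgroup G)⁆).Normal := by
    refine ⟨fun x hx g => ?_⟩
    have h1 : ⁅x, g⁆ ∈ ⁅N, (⊤ : Subgroup G)⁆ :=
      Subgroup.commutator_mem_commutator (hle hx) (Subgroup.mem_top g)
    have h2 : g * x * g⁻¹ = ⁅x, g⁆⁻¹ * x := by simp [commutatorElement_def, mul_assoc]
    rw [h2]
    exact mul_mem (inv_mem (Subgroup.mem_sup_right h1)) hx
  have hmem : v ∈ Subgroup.zpowers u ⊔ ⁅N, (⊤ : Subgroup G)⁆ :=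
    Subgroup.normalClosure_le_normal (by
      simpa using Subgroup.mem_sup_left (Subgroup.mem_zpowers u)) h
  obtain ⟨x, ⟨k, rfl⟩, d, hd, rfl⟩ := Subgroup.mem_sup_of_normal_right.1 hmem
  exact ⟨k, by simpa using hd⟩

theorem MonoidHom.map_mem_normalClosure_singleton {G H : Type*} [Group G] [Group H] (f : G →* H)
    {u v : G} (h : v ∈ Subgroup.normalClosure {u}) : f v ∈ Subgroup.normalClosure {f u} := by
  have := Subgroup.map_normalClosure_le {u} f (Subgroup.mem_map_of_mem f h)
  rwa [Set.image_singleton] at this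

theorem MonoidHom.normalClosure_singleton_congr {G H : Type*} [Group G] [Group H] (f : G →* H)
    {u v : G} (h : Subgroup.normalClosure {u} = Subgroup.normalClosure {v}) :
    Subgroup.normalClosure {f u} = Subgroup.normalClosure {f v} := by
  refine le_antisymm (Subgroup.normalClosure_le_normal ?_) (Subgroup.normalClosure_le_normal ?_)
  · rw [Set.singleton_subset_iff]
    exact f.map_mem_normalClosure_singleton (h ▸ Subgroup.subset_normalClosure rfl)
  · rw [Set.singleton_subset_iff]
    exact f.map_mem_normalClosure_singleton (h ▸ Subgroup.subset_normalClosure rfl)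

theorem MonoidHom.map_mem_commutator_normalClosure {G H : Type*} [Group G] [Group H] (f : G →* H)
    {u x : G} (h : x ∈ ⁅Subgroup.normalClosure {u}, (⊤ : Subgroup G)⁆) :
    f x ∈ ⁅Subgroup.normalClosure {f u}, (⊤ : Subgroup H)⁆ := by
  have h1 := Subgroup.mem_map_of_mem f h
  rw [Subgroup.map_commutator] at h1
  refine Subgroup.commutator_mono ?_ le_top h1
  rintro _ ⟨y, hy, rfl⟩
  exact f.map_mem_normalClosure_singleton hy

/-- If `b` is congruent to `a ^ k` and conjugate to `a ^ e`, then `a ^ e` and `a ^ k` are congruent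
modulo `⁅⟪a⟫, G⁆`. -/
theorem IsConj.zpow_sub_mem_commutator {G : Type*} [Group G] {a b : G} {k e : ℤ}
    (hb : IsConj (a ^ e) b)
    (h : a ^ (-k) * b ∈ ⁅Subgroup.normalClosure {a}, (⊤ : Subgroup G)⁆) :
    a ^ (e - k) ∈ ⁅Subgroup.normalClosure {a}, (⊤ : Subgroup G)⁆ := by
  obtain ⟨g, rfl⟩ := isConj_iff.1 hb
  have ha : a ^ e ∈ Subgroup.normalClosure {a} :=
    zpow_mem (Subgroup.subset_normalClosure (Set.mem_singleton a)) e
  have h1 : ⁅a ^ e, g⁆ ∈ ⁅Subgroup.normalClosure {a}, (⊤ : Subgroup G)⁆ :=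
    Subgroup.commutator_mem_commutator ha (Subgroup.mem_top g)
  have h2 : a ^ (e - k) =
      a ^ (-k) * ⁅a ^ e, g⁆ * (a ^ (-k))⁻¹ * (a ^ (-k) * (g * a ^ e * g⁻¹)) := by
    rw [commutatorElement_def, sub_eq_neg_add, zpow_add]
    generalize a ^ (-k) = x
    generalize a ^ e = y
    group
  rw [h2]
  exact mul_mem (Subgroup.Normal.conj_mem (Subgroup.commutator_normal _ _) _ h1 _) h

theorem HasMagnusProperty.exists_isConj_zpow {G : Type*} [Group G] (hG : HasMagnusProperty G)
    {a b : G} (h : Subgroup.normalClosure {a} = Subgroup.normalClosure {b}) :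
    ∃ e : ℤ, (e = 1 ∨ e = -1) ∧ IsConj (a ^ e) b := by
  rcases hG a b h with h | h
  · exact ⟨1, Or.inl rfl, by simpa using h⟩
  · refine ⟨-1, Or.inr rfl, ?_⟩
    obtain ⟨g, hg⟩ := isConj_iff.1 h
    exact isConj_iff.2 ⟨g, by rw [← inv_inv b, ← hg]; group⟩

/-! ### The Magnus representation of a free group -/

namespace MagnusRep

variable {α : Type*}

/-- Left multiplication by the variable `x` on the functions `List α → ℤ`, regarded as formal
power series in noncommuting variables in which all squares of variables are zero: the value at a
list is the coefficient of the corresponding monomial. -/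
noncomputable def leftMul (x : α) : Module.End ℤ (List α → ℤ) where
  toFun f
    | [] => 0
    | y :: t => open scoped Classical in if y = x ∧ t.head? ≠ some x then f t else 0
  map_add' f g := by
    funext l
    cases l with
    | nil => simp
    | cons y t => simp only [Pi.add_apply]; split_ifs <;> simp
  map_smul' n f := by
    funext l
    cases l with
    | nil => simp
    | cons y t => simp

@[simp]
theorem leftMul_nil (x : α) (f : List α → ℤ) : leftMul x f [] = 0 := rfl

theorem leftMul_cons_self {x : α} (f : List α → ℤ) {t : List α} (h : t.head? ≠ some x) :
    leftMul x f (x :: t) = f t := by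
  simp [leftMul, h]

theorem leftMul_eq_zero {x : α} {f : List α → ℤ} {l : List α}
    (h : ∀ t, l = x :: t → t.head? ≠ some x → f t = 0) : leftMul x f l = 0 := by
  cases l with
  | nil => rfl
  | cons y t =>
    by_cases hy : y = x ∧ t.head? ≠ some x
    · obtain ⟨rfl, ht⟩ := hy
      rw [leftMul_cons_self f ht, h t rfl ht]
    · simp only [leftMul, LinearMap.coe_mk, AddHom.coe_mk, if_neg hy]

theorem leftMul_mul_self (x : α) : leftMul x * leftMul x = 0 := by
  refine LinearMap.ext fun f => funext fun l => ?_
  refine leftMul_eq_zero fun t _ ht => leftMul_eq_zero fun s hs _ => ?_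
  simp [hs] at ht

/-- The Magnus representation `x ↦ 1 + X`. Since `X ^ 2 = 0`, the inverse of `1 + X` is `1 - X`. -/
noncomputable def rep (α : Type*) : FreeGroup α →* (Module.End ℤ (List α → ℤ))ˣ :=
  FreeGroup.lift fun x =>
    ⟨1 + leftMul x, 1 - leftMul x,
      by simp [mul_sub, add_mul, leftMul_mul_self],
      by simp [mul_add, sub_mul, leftMul_mul_self]⟩

/-- An endomorphism has degree at least `k` if it raises the order of vanishing (the least length of
a monomial with nonzero coefficient) by at least `k`. -/
def DegreeGE (k : ℕ) (T : Module.End ℤ (List α → ℤ)) : Prop :=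
  ∀ (j : ℕ) (f : List α → ℤ), (∀ l, l.length < j → f l = 0) → ∀ l, l.length < j + k → T f l = 0

namespace DegreeGE

variable {k m : ℕ} {S T : Module.End ℤ (List α → ℤ)}

theorem add (hS : DegreeGE k S) (hT : DegreeGE k T) : DegreeGE k (S + T) := fun j f hf l hl => by
  simp [hS j f hf l hl, hT j f hf l hl]

theorem neg (hT : DegreeGE k T) : DegreeGE k (-T) := fun j f hf l hl => by
  simp [hT j f hf l hl]

theorem sub (hS : DegreeGE k S) (hT : DegreeGE k T) : DegreeGE k (S - T) :=
  sub_eq_add_neg S T ▸ hS.add hT.neg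

theorem mul (hS : DegreeGE k S) (hT : DegreeGE m T) : DegreeGE (k + m) (S * T) :=
  fun j f hf l hl => hS (j + m) (T f) (hT j f hf) l (by omega)

theorem mono (hT : DegreeGE k T) (h : m ≤ k) : DegreeGE m T :=
  fun j f hf l hl => hT j f hf l (by omega)

theorem nsmul (n : ℕ) (hT : DegreeGE k T) : DegreeGE k (n • T) := fun j f hf l hl => by
  simp [hT j f hf l hl]

theorem of_nsmul {n : ℕ} (hn : n ≠ 0) (hT : DegreeGE k (n • T)) : DegreeGE k T :=
  fun j f hf l hl => by simpa [hn] using hT j f hf l hl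

theorem zero : DegreeGE k (0 : Module.End ℤ (List α → ℤ)) := fun _ _ _ _ _ => rfl

theorem one : DegreeGE 0 (1 : Module.End ℤ (List α → ℤ)) := fun _ _ hf l hl => hf l hl

theorem leftMul (x : α) : DegreeGE 1 (leftMul x) := fun j f hf l hl =>
  leftMul_eq_zero fun t ht _ => hf t (by simp [ht] at hl; omega)

end DegreeGE

theorem degreeGE_one_rep_sub_one (g : FreeGroup α) :
    DegreeGE 1 ((rep α g : Module.End ℤ (List α → ℤ)) - 1) := by
  induction g using FreeGroup.induction_on with
  | C1 => simpa using DegreeGE.zero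
  | of x => simpa [rep] using DegreeGE.leftMul x
  | inv_of x _ => simpa [rep, Units.inv_mk] using (DegreeGE.leftMul x).neg
  | mul g h hg hh =>
    have e : (rep α (g * h) : Module.End ℤ (List α → ℤ)) - 1 =
        (rep α g - 1) * (rep α h - 1) + (rep α g - 1) + (rep α h - 1) := by
      rw [map_mul, Units.val_mul]; noncomm_ring
    rw [e]
    exact (((hg.mul hh).mono (by omega)).add hg).add hh

theorem degreeGE_zero_rep (g : FreeGroup α) :
    DegreeGE 0 (rep α g : Module.End ℤ (List α → ℤ)) := by
  simpa using ((degreeGE_one_rep_sub_one g).mono zero_le_one).add DegreeGE.one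

/-- The elements acting trivially modulo degree `k`: the analogue of the `k`-th dimension subgroup for
power series in which squares of variables vanish. -/
def dimensionSubgroup (α : Type*) (k : ℕ) : Subgroup (FreeGroup α) where
  carrier := {g | DegreeGE k ((rep α g : Module.End ℤ (List α → ℤ)) - 1)}
  one_mem' := by simpa using DegreeGE.zero
  mul_mem' {g h} hg hh := by
    have e : (rep α (g * h) : Module.End ℤ (List α → ℤ)) - 1 =
        (rep α g - 1) * rep α h + (rep α h - 1) := by
      rw [map_mul, Units.val_mul]; noncomm_ring
    rw [Set.mem_ofPred_eq, e]
    exact (hg.mul (degreeGE_zero_rep h)).add hh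
  inv_mem' {g} hg := by
    have e : (rep α g⁻¹ : Module.End ℤ (List α → ℤ)) - 1 = -((rep α g - 1) * rep α g⁻¹) := by
      rw [sub_mul, ← Units.val_mul, ← map_mul]; simp
    rw [Set.mem_ofPred_eq, e]
    exact (hg.mul (degreeGE_zero_rep g⁻¹)).neg

theorem mem_dimensionSubgroup {k : ℕ} {g : FreeGroup α} :
    g ∈ dimensionSubgroup α k ↔ DegreeGE k ((rep α g : Module.End ℤ (List α → ℤ)) - 1) := Iff.rfl

instance (k : ℕ) : (dimensionSubgroup α k).Normal := by
  refine ⟨fun g hg h => ?_⟩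
  have e : (rep α (h * g * h⁻¹) : Module.End ℤ (List α → ℤ)) - 1 =
      rep α h * (rep α g - 1) * rep α h⁻¹ := by
    rw [mul_sub, sub_mul, ← Units.val_mul, ← Units.val_mul, ← map_mul, ← map_mul, mul_one,
      ← Units.val_mul, ← map_mul]
    simp
  rw [mem_dimensionSubgroup, e]
  simpa using ((degreeGE_zero_rep h).mul hg).mul (degreeGE_zero_rep h⁻¹)

theorem commutator_dimensionSubgroup_le (k : ℕ) :
    ⁅dimensionSubgroup α k, (⊤ : Subgroup (FreeGroup α))⁆ ≤ dimensionSubgroup α (k + 1) := by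
  rw [Subgroup.commutator_le]
  intro g hg h _
  have e : (rep α ⁅g, h⁆ : Module.End ℤ (List α → ℤ)) - 1 =
      ((rep α g - 1) * (rep α h - 1) - (rep α h - 1) * (rep α g - 1)) * rep α (h * g)⁻¹ := by
    have e1 : ((rep α g - 1) * (rep α h - 1) - (rep α h - 1) * (rep α g - 1) :
        Module.End ℤ (List α → ℤ)) = rep α (g * h) - rep α (h * g) := by
      rw [map_mul, Units.val_mul, map_mul, Units.val_mul]; noncomm_ring
    rw [e1, sub_mul, ← Units.val_mul, ← Units.val_mul, ← map_mul, ← map_mul]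
    simp [commutatorElement_def, mul_assoc]
  rw [mem_dimensionSubgroup, e]
  have hh := degreeGE_one_rep_sub_one h
  exact ((hg.mul hh).sub ((hh.mul hg).mono (by omega))).mul (degreeGE_zero_rep (h * g)⁻¹)

/-- If `g` acts as `1 + t` with `t` of degree at least `k`, then `g ^ n` acts as `1 + n t` modulo
degree `k + 1`. -/
theorem degreeGE_rep_pow {k : ℕ} (hk : 1 ≤ k) {g : FreeGroup α} (hg : g ∈ dimensionSubgroup α k)
    (n : ℕ) : DegreeGE (k + 1) ((rep α (g ^ n) : Module.End ℤ (List α → ℤ)) - 1 -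
      n • ((rep α g : Module.End ℤ (List α → ℤ)) - 1)) := by
  induction n with
  | zero => simpa using DegreeGE.zero
  | succ n ih =>
    have e : (rep α (g ^ (n + 1)) : Module.End ℤ (List α → ℤ)) - 1 -
        (n + 1) • ((rep α g : Module.End ℤ (List α → ℤ)) - 1) =
        (rep α (g ^ n) - 1 - n • (rep α g - 1)) * rep α g +
          n • ((rep α g - 1) * (rep α g - 1)) := by
      rw [pow_succ, map_mul, Units.val_mul]
      simp only [nsmul_eq_mul, Nat.cast_add, Nat.cast_one]
      noncomm_ring
    rw [e]
    exact (ih.mul (degreeGE_zero_rep g)).add (((hg.mul hg).mono (by omega)).nsmul n)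

theorem mem_dimensionSubgroup_of_pow_mem {k n : ℕ} (hk : 1 ≤ k) (hn : n ≠ 0) {g : FreeGroup α}
    (hg : g ∈ dimensionSubgroup α k) (h : g ^ n ∈ dimensionSubgroup α (k + 1)) :
    g ∈ dimensionSubgroup α (k + 1) := by
  refine DegreeGE.of_nsmul hn ?_
  have := (mem_dimensionSubgroup.1 h).sub (degreeGE_rep_pow hk hg n)
  rwa [sub_sub_cancel] at this

/-- The list `t` is the leading monomial of `f`: among the monomials of length at least that of `t`,
it is the only one with nonzero coefficient. -/
def IsLeading (f : List α → ℤ) (t : List α) : Prop :=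
  f t ≠ 0 ∧ ∀ m : List α, t.length ≤ m.length → m ≠ t → f m = 0

theorem IsLeading.add_smul_leftMul {f : List α → ℤ} {t : List α} (h : IsLeading f t) {x : α}
    (hx : t.head? ≠ some x) {n : ℤ} (hn : n ≠ 0) : IsLeading (f + n • leftMul x f) (x :: t) := by
  constructor
  · simp [leftMul_cons_self f hx, h.2 (x :: t) (by simp) (by simp), hn, h.1]
  · intro m hm hne
    have h1 : f m = 0 := h.2 m (by simp at hm; omega) (by rintro rfl; simp at hm)
    have h2 : leftMul x f m = 0 := leftMul_eq_zero fun s hs _ =>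
      h.2 s (by simp [hs] at hm; omega) (by rintro rfl; exact hne hs)
    simp [h1, h2]

/-- The power series `1`. -/
def unit : List α → ℤ
  | [] => 1
  | _ :: _ => 0

theorem rep_mk_cons_apply (x : α) (e : Bool) (L : List (α × Bool)) (f : List α → ℤ) :
    (rep α (FreeGroup.mk ((x, e) :: L)) : Module.End ℤ (List α → ℤ)) f =
      (rep α (FreeGroup.mk L) : Module.End ℤ (List α → ℤ)) f +
        (if e then 1 else -1 : ℤ) •
          leftMul x ((rep α (FreeGroup.mk L) : Module.End ℤ (List α → ℤ)) f) := by
  cases e <;> simp [rep, sub_eq_add_neg]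

/-- A reduced word with first syllable `x ^ n` sends `1` to `(1 + n X) f`, where `f` is the image of `1`
under the rest of the word and has a leading monomial not starting with `x`. The sign of `n` is that
of the first letter, so that `n` stays nonzero when the syllable is lengthened. -/
theorem exists_isLeading_of_isReduced (L : List (α × Bool)) :
    ∀ (x : α) (e : Bool), FreeGroup.IsReduced ((x, e) :: L) →
      ∃ (f : List α → ℤ) (t : List α) (n : ℤ), IsLeading f t ∧ t.head? ≠ some x ∧
        0 < (if e then 1 else -1) * n ∧
        (rep α (FreeGroup.mk ((x, e) :: L)) : Module.End ℤ (List α → ℤ)) unit =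
          f + n • leftMul x f := by
  induction L with
  | nil =>
    intro x e _
    refine ⟨unit, [], if e then 1 else -1, ⟨by simp [unit], ?_⟩, by simp, by cases e <;> simp, ?_⟩
    · rintro (_ | ⟨y, m⟩) _ h
      · exact absurd rfl h
      · rfl
    · rw [rep_mk_cons_apply]
      simp [← FreeGroup.one_eq_mk]
  | cons p L ih =>
    obtain ⟨y, d⟩ := p
    intro x e hred
    obtain ⟨hxy, hred'⟩ := FreeGroup.isReduced_cons_cons.1 hred
    obtain ⟨f, t, n, hf, ht, hn, hrep⟩ := ih y d hred'
    rw [rep_mk_cons_apply, hrep]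
    by_cases h : x = y
    · subst h
      obtain rfl : e = d := hxy rfl
      refine ⟨f, t, n + if e then 1 else -1, hf, ht, ?_, ?_⟩
      · cases e <;> simp at hn ⊢ <;> omega
      · have h0 : leftMul x (leftMul x f) = 0 := LinearMap.congr_fun (leftMul_mul_self x) f
        rw [map_add, map_smul, h0, smul_zero, add_zero, add_smul, add_assoc]
    · have hn0 : n ≠ 0 := by rintro rfl; simp at hn
      refine ⟨f + n • leftMul y f, y :: t, if e then 1 else -1, hf.add_smul_leftMul ht hn0, ?_,
        by cases e <;> simp, rfl⟩
      simpa using Ne.symm h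

theorem rep_injective : Function.Injective (rep α) := by
  classical
  rw [injective_iff_map_eq_one]
  intro g hg
  by_contra hne
  rw [← FreeGroup.toWord_eq_nil_iff] at hne
  obtain ⟨⟨x, e⟩, L, hL⟩ := List.exists_cons_of_ne_nil hne
  obtain ⟨f, t, n, hf, ht, hn, hrep⟩ := exists_isLeading_of_isReduced L x e
    (hL ▸ FreeGroup.isReduced_toWord)
  have hn0 : n ≠ 0 := by rintro rfl; simp at hn
  rw [← hL, FreeGroup.mk_toWord, hg] at hrep
  refine (hf.add_smul_leftMul ht hn0).1 ?_
  rw [← hrep]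
  rfl

theorem eq_one_of_forall_mem_dimensionSubgroup {g : FreeGroup α}
    (h : ∀ k, g ∈ dimensionSubgroup α k) : g = 1 := by
  refine rep_injective ?_
  rw [map_one]
  refine Units.ext (sub_eq_zero.1 (LinearMap.ext fun f => funext fun l => ?_))
  exact h (l.length + 1) 0 f (by simp) l (by omega)

end MagnusRep

/-- In a free group, a nontrivial element has infinite order modulo the commutator of its normal
closure with the whole group. -/
theorem FreeGroup.eq_one_of_pow_mem_commutator {α : Type*} {a : FreeGroup α} {n : ℕ} (hn : n ≠ 0)
    (h : a ^ n ∈ ⁅Subgroup.normalClosure {a}, (⊤ : Subgroup (FreeGroup α))⁆) : a = 1 := by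
  -- By induction, `a` lies in every dimension subgroup.
  have key : ∀ k, a ∈ MagnusRep.dimensionSubgroup α (k + 1) := by
    intro k
    induction k with
    | zero => exact MagnusRep.degreeGE_one_rep_sub_one a
    | succ k ih =>
      refine MagnusRep.mem_dimensionSubgroup_of_pow_mem (by omega) hn ih ?_
      refine MagnusRep.commutator_dimensionSubgroup_le (k + 1) (Subgroup.commutator_mono ?_ le_rfl h)
      exact Subgroup.normalClosure_le_normal (by simpa using ih)
  refine MagnusRep.eq_one_of_forall_mem_dimensionSubgroup fun k => ?_
  exact (MagnusRep.mem_dimensionSubgroup.1 (key k)).mono (by omega)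

theorem IsLimitGroup.eq_zero_of_zpow_mem_commutator {L : Type*} [Group L] (hL : IsLimitGroup L)
    {a : L} (ha : a ≠ 1) {n : ℤ}
    (h : a ^ n ∈ ⁅Subgroup.normalClosure {a}, (⊤ : Subgroup L)⁆) : n = 0 := by
  classical
  by_contra hn
  obtain ⟨α, f, hf⟩ := hL.fullyResiduallyFree {a, 1}
  have hfa : f a ≠ 1 := fun h1 => ha (hf (by simp) (by simp) (by rw [h1, map_one]))
  refine hfa (FreeGroup.eq_one_of_pow_mem_commutator (Int.natAbs_ne_zero.2 hn) ?_)
  have h1 := f.map_mem_commutator_normalClosure h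
  rw [map_zpow] at h1
  rcases Int.natAbs_eq n with h2 | h2
  · rwa [h2, zpow_natCast] at h1
  · rw [h2, zpow_neg, zpow_natCast] at h1
    exact inv_mem_iff.1 h1

/-! ### Factors with a detectable exponent -/

/-- A strengthening of the Magnus property in which the exponent of the conjugacy is read off from
the central quotient: if `a ≠ 1` and `b` have the same normal closure `N` and `b` is congruent to
`a ^ k` modulo `⁅N, G⁆`, then `k = ±1` and `b` is conjugate to `a ^ k`. -/
def HasDetectingMagnusProperty (G : Type*) [Group G] : Prop :=
  ∀ (a b : G) (k : ℤ), a ≠ 1 → Subgroup.normalClosure {a} = Subgroup.normalClosure {b} →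
    a ^ (-k) * b ∈ ⁅Subgroup.normalClosure {a}, (⊤ : Subgroup G)⁆ →
      (k = 1 ∨ k = -1) ∧ IsConj (a ^ k) b

theorem IsLimitGroup.hasDetectingMagnusProperty {L : Type*} [Group L] (hL : IsLimitGroup L)
    (hM : HasMagnusProperty L) : HasDetectingMagnusProperty L := by
  intro a b k ha hab hk
  obtain ⟨e, he, hconj⟩ := hM.exists_isConj_zpow hab
  obtain rfl : e = k :=
    sub_eq_zero.1 (hL.eq_zero_of_zpow_mem_commutator ha (hconj.zpow_sub_mem_commutator hk))
  exact ⟨he, hconj⟩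

theorem eq_one_of_normalClosure_eq {G : Type*} [Group G] {b : G}
    (h : Subgroup.normalClosure {(1 : G)} = Subgroup.normalClosure {b}) : b = 1 := by
  have hb : b ∈ Subgroup.normalClosure {(1 : G)} := h ▸ Subgroup.subset_normalClosure rfl
  rwa [Subgroup.normalClosure_eq_bot_iff.2 le_rfl, Subgroup.mem_bot] at hb

/-- In a subdirect product of groups with the detecting property, the same exponent works in all
coordinates. Conjugators can be taken trivial wherever both coordinates are. -/
theorem exists_coordinate_conjugators {ι : Type*} {G : ι → Type*} [∀ i, Group (G i)]
    (hG : ∀ i, HasDetectingMagnusProperty (G i)) {X : Type*} [Group X] (p : ∀ i, X →* G i)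
    (hp : ∀ x, (∀ i, p i x = 1) → x = 1) {a b : X} {k : ℤ} (ha : a ≠ 1)
    (hab : Subgroup.normalClosure {a} = Subgroup.normalClosure {b})
    (hk : a ^ (-k) * b ∈ ⁅Subgroup.normalClosure {a}, (⊤ : Subgroup X)⁆) :
    (k = 1 ∨ k = -1) ∧ ∃ g : ∀ i, G i,
      (∀ i, p i a = 1 → g i = 1) ∧ ∀ i, g i * p i a ^ k * (g i)⁻¹ = p i b := by
  have hk' (i : ι) : p i a ^ (-k) * p i b ∈
      ⁅Subgroup.normalClosure {p i a}, (⊤ : Subgroup (G i))⁆ := by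
    simpa using (p i).map_mem_commutator_normalClosure hk
  have hab' (i : ι) := (p i).normalClosure_singleton_congr hab
  constructor
  · obtain ⟨i, hi⟩ : ∃ i, p i a ≠ 1 := by
      by_contra! h
      exact ha (hp a h)
    exact (hG i _ _ k hi (hab' i) (hk' i)).1
  · have h (i : ι) : ∃ g : G i, (p i a = 1 → g = 1) ∧ g * p i a ^ k * g⁻¹ = p i b := by
      by_cases hi : p i a = 1
      · have hb := hab' i
        rw [hi] at hb
        exact ⟨1, fun _ => rfl, by simp [hi, eq_one_of_normalClosure_eq hb]⟩
      · obtain ⟨g, hg⟩ := isConj_iff.1 (hG i _ _ k hi (hab' i) (hk' i)).2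
        exact ⟨g, fun h => absurd h hi, hg⟩
    choose g hg using h
    exact ⟨g, fun i => (hg i).1, fun i => (hg i).2⟩

theorem HasDetectingMagnusProperty.pi {ι : Type*} {G : ι → Type*} [∀ i, Group (G i)]
    (hG : ∀ i, HasDetectingMagnusProperty (G i)) : HasDetectingMagnusProperty (∀ i, G i) := by
  intro a b k ha hab hk
  obtain ⟨hk1, g, -, hg⟩ := exists_coordinate_conjugators hG (fun i => Pi.evalMonoidHom G i)
    (fun x hx => funext hx) ha hab hk
  exact ⟨hk1, isConj_iff.2 ⟨g, funext hg⟩⟩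

theorem HasDetectingMagnusProperty.restrictedDirectProduct {ι : Type*} {G : ι → Type*}
    [∀ i, Group (G i)] (hG : ∀ i, HasDetectingMagnusProperty (G i)) :
    HasDetectingMagnusProperty (RestrictedDirectProduct G) := by
  intro a b k ha hab hk
  obtain ⟨hk1, g, hg1, hg⟩ := exists_coordinate_conjugators hG
    (fun i => RestrictedProduct.evalMonoidHom G i)
    (fun x hx => RestrictedProduct.ext G _ hx) ha hab hk
  refine ⟨hk1, isConj_iff.2 ⟨RestrictedProduct.mk g ?_, RestrictedProduct.ext G _ hg⟩⟩
  exact a.2.mono fun i hi => Subgroup.mem_bot.2 (hg1 i (Subgroup.mem_bot.1 hi))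

/-! ### The condition on the complementary factor -/

/-- The condition on `C` characterising the groups for which the direct product with a nontrivial
limit group having the Magnus property again has it. -/
def IsMagnusComplement (C : Type*) [Group C] : Prop :=
  HasMagnusProperty C ∧ ∀ c : C,
    c ^ (2 : ℤ) ∈ ⁅Subgroup.normalClosure {c}, (⊤ : Subgroup C)⁆ → IsConj c c⁻¹

theorem isConj_prodMk {G H : Type*} [Group G] [Group H] {a b : G} {c d : H} :
    IsConj (a, c) (b, d) ↔ IsConj a b ∧ IsConj c d := by
  simp only [isConj_iff, Prod.exists, Prod.mk_mul_mk, Prod.inv_mk, Prod.mk.injEq]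
  exact ⟨fun ⟨g, h, h1, h2⟩ => ⟨⟨g, h1⟩, ⟨h, h2⟩⟩, fun ⟨⟨g, h1⟩, ⟨h, h2⟩⟩ => ⟨g, h, h1, h2⟩⟩

theorem IsMagnusComplement.hasMagnusProperty_prod {X C : Type*} [Group X] [Group C]
    (hC : IsMagnusComplement C) (hX : HasDetectingMagnusProperty X) :
    HasMagnusProperty (X × C) := by
  rintro ⟨a, c⟩ ⟨b, d⟩ h
  have hab := (MonoidHom.fst X C).normalClosure_singleton_congr h
  have hcd := (MonoidHom.snd X C).normalClosure_singleton_congr h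
  simp only [MonoidHom.coe_fst, MonoidHom.coe_snd] at hab hcd
  by_cases ha : a = 1
  · subst ha
    obtain rfl := eq_one_of_normalClosure_eq hab
    simpa [isConj_prodMk] using hC.1 c d hcd
  · obtain ⟨k, hk⟩ := exists_zpow_neg_mul_mem_commutator
      (show (b, d) ∈ Subgroup.normalClosure {(a, c)} from h ▸ Subgroup.subset_normalClosure rfl)
    have hka : a ^ (-k) * b ∈ ⁅Subgroup.normalClosure {a}, (⊤ : Subgroup X)⁆ := by
      simpa using (MonoidHom.fst X C).map_mem_commutator_normalClosure hk
    have hkc : c ^ (-k) * d ∈ ⁅Subgroup.normalClosure {c}, (⊤ : Subgroup C)⁆ := by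
      simpa using (MonoidHom.snd X C).map_mem_commutator_normalClosure hk
    obtain ⟨hk1, hconj⟩ := hX a b k ha hab hka
    obtain ⟨e, he, hce⟩ := hC.1.exists_isConj_zpow hcd
    have hmem := hce.zpow_sub_mem_commutator hkc
    -- If the exponents `e` and `k` disagree, then `c ^ 2 ∈ ⁅⟪c⟫, C⁆` and the sign can be changed.
    have hck : IsConj (c ^ k) d := by
      rcases eq_or_ne e k with rfl | hne
      · exact hce
      · have h2 : c ^ (2 : ℤ) ∈ ⁅Subgroup.normalClosure {c}, (⊤ : Subgroup C)⁆ := by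
          rcases he with rfl | rfl <;> rcases hk1 with rfl | rfl
          · exact absurd rfl hne
          · exact hmem
          · rw [← inv_mem_iff, ← zpow_neg]; exact hmem
          · exact absurd rfl hne
        have h3 := hC.2 c h2
        rcases he with rfl | rfl <;> rcases hk1 with rfl | rfl
        · exact absurd rfl hne
        · simpa using h3.symm.trans (by simpa using hce)
        · simpa using h3.trans (by simpa using hce)
        · exact absurd rfl hne
    have hboth : IsConj ((a, c) ^ k) (b, d) := isConj_prodMk.2 ⟨hconj, hck⟩
    rcases hk1 with rfl | rfl
    · exact Or.inl (by simpa using hboth)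
    · refine Or.inr ?_
      obtain ⟨g, hg⟩ := isConj_iff.1 hboth
      exact isConj_iff.2 ⟨g, by rw [← hg]; group⟩

/-- The normal closure of `(l, c)` contains `1 × ⁅⟪c⟫, C⁆`. -/
theorem prodMk_one_mem_normalClosure {X C : Type*} [Group X] [Group C] (l : X) {c x : C}
    (hx : x ∈ ⁅Subgroup.normalClosure {c}, (⊤ : Subgroup C)⁆) :
    ((1 : X), x) ∈ Subgroup.normalClosure {(l, c)} := by
  set N := Subgroup.normalClosure {(l, c)}
  suffices h : ⁅Subgroup.normalClosure {c}, (⊤ : Subgroup C)⁆ ≤ N.comap (MonoidHom.inr X C) from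
    h hx
  rw [Subgroup.commutator_le]
  intro g hg h _
  -- Lift `g` to `(y, g) ∈ N`; then `(1, ⁅g, h⁆) = ⁅(y, g), (1, h)⁆`.
  have hmap := Subgroup.map_normalClosure {(l, c)} (MonoidHom.snd X C) Prod.snd_surjective
  rw [Set.image_singleton, MonoidHom.coe_snd] at hmap
  rw [← hmap] at hg
  obtain ⟨⟨y, _⟩, hy, rfl⟩ := hg
  have hcomm := Subgroup.commutator_le_left N ⊤
    (Subgroup.commutator_mem_commutator hy (Subgroup.mem_top ((1 : X), h)))
  simpa [commutatorElement_def] using hcomm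

theorem normalClosure_singleton_inv {G : Type*} [Group G] (c : G) :
    Subgroup.normalClosure {c⁻¹} = Subgroup.normalClosure {c} := by
  refine le_antisymm (Subgroup.normalClosure_le_normal ?_) (Subgroup.normalClosure_le_normal ?_)
  · simpa using inv_mem (Subgroup.subset_normalClosure (Set.mem_singleton c))
  · simpa using Subgroup.subset_normalClosure (Set.mem_singleton c⁻¹)

/-- If `c ^ 2 ∈ ⁅⟪c⟫, C⁆`, then `(l, c)` and `(l, c⁻¹)` have the same normal closure, since they
differ by the element `(1, c ^ 2)`. -/
theorem normalClosure_prodMk_inv_eq {X C : Type*} [Group X] [Group C] (l : X) {c : C}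
    (hc : c ^ (2 : ℤ) ∈ ⁅Subgroup.normalClosure {c}, (⊤ : Subgroup C)⁆) :
    Subgroup.normalClosure {(l, c)} = Subgroup.normalClosure {(l, c⁻¹)} := by
  have key : ∀ d : C, d ^ (2 : ℤ) ∈ ⁅Subgroup.normalClosure {d}, (⊤ : Subgroup C)⁆ →
      Subgroup.normalClosure {(l, d⁻¹)} ≤ Subgroup.normalClosure {(l, d)} := by
    intro d hd
    refine Subgroup.normalClosure_le_normal (Set.singleton_subset_iff.2 ?_)
    have h1 := prodMk_one_mem_normalClosure l (inv_mem hd)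
    have h2 : (l, d⁻¹) = (l, d) * (1, (d ^ (2 : ℤ))⁻¹) := by
      ext
      · simp
      · simp only [Prod.mk_mul_mk]; group
    rw [SetLike.mem_coe, h2]
    exact mul_mem (Subgroup.subset_normalClosure rfl) h1
  refine le_antisymm ?_ (key c hc)
  have h := key c⁻¹ (by rw [normalClosure_singleton_inv, inv_zpow]; exact inv_mem hc)
  rwa [inv_inv] at h

theorem IsMagnusComplement.of_prod {X C : Type*} [Group X] [Group C] {l : X}
    (hl : ¬ IsConj l l⁻¹) (h : HasMagnusProperty (X × C)) : IsMagnusComplement C := by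
  constructor
  · intro c d hcd
    simpa [isConj_prodMk] using h (1, c) (1, d)
      ((MonoidHom.inr X C).normalClosure_singleton_congr hcd)
  · intro c hc
    rcases h _ _ (normalClosure_prodMk_inv_eq l hc) with h1 | h1
    · exact (isConj_prodMk.1 h1).2
    · exact absurd (isConj_prodMk.1 h1).1 hl

theorem HasDetectingMagnusProperty.not_isConj_inv {G : Type*} [Group G]
    (hG : HasDetectingMagnusProperty G) {l : G} (hl : l ≠ 1) : ¬ IsConj l l⁻¹ := by
  intro h
  -- If `l` is conjugate to `l⁻¹`, then `l ^ 2 ∈ ⁅⟪l⟫, G⁆`, so that `l` is congruent to `l ^ 3`; but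
  -- the exponent `3` is not allowed.
  have h2 : l ^ (1 - (-1) : ℤ) ∈ ⁅Subgroup.normalClosure {l}, (⊤ : Subgroup G)⁆ :=
    IsConj.zpow_sub_mem_commutator (b := l⁻¹) (by simpa using h) (by simp [one_mem])
  have h3 := (hG l l 3 hl rfl (by
    rw [← inv_mem_iff]
    have : (l ^ (-3 : ℤ) * l)⁻¹ = l ^ (1 - (-1) : ℤ) := by group
    rwa [this])).1
  omega

/-! ### The infinite cyclic group -/

theorem isLimitGroup_uLift_multiplicative_int : IsLimitGroup (ULift (Multiplicative ℤ)) where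
  fg := Group.fg_of_surjective (f := (MulEquiv.ulift (α := Multiplicative ℤ)).symm.toMonoidHom)
    (MulEquiv.ulift (α := Multiplicative ℤ)).symm.surjective
  fullyResiduallyFree S := by
    let s : FreeGroup Unit →* Multiplicative ℤ := FreeGroup.lift fun _ => Multiplicative.ofAdd 1
    refine ⟨Unit, (zpowersHom _ (FreeGroup.of ())).comp MulEquiv.ulift.toMonoidHom, ?_⟩
    refine (Function.LeftInverse.injective (g := fun w => ULift.up (s w)) fun n => ?_).injOn
    obtain ⟨n⟩ := n
    simp [s, zpowersHom_apply, ← ofAdd_zsmul]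
    rfl

theorem hasMagnusProperty_uLift_multiplicative_int :
    HasMagnusProperty (ULift (Multiplicative ℤ)) := by
  rintro ⟨u⟩ ⟨v⟩ h
  have h' := (MulEquiv.ulift (α := Multiplicative ℤ)).toMonoidHom.normalClosure_singleton_congr h
  have key : ∀ {x y : Multiplicative ℤ}, x ∈ Subgroup.normalClosure {y} →
      Multiplicative.toAdd y ∣ Multiplicative.toAdd x := by
    intro x y hx
    have h1 : x ∈ Subgroup.zpowers y :=
      Subgroup.normalClosure_le_normal (by simp) hx
    obtain ⟨k, rfl⟩ := h1
    simp
  have huv : u = v ∨ u = v⁻¹ := by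
    rcases Int.natAbs_eq_natAbs_iff.1 (Int.natAbs_eq_of_dvd_dvd
      (key (x := v) (y := u) (h' ▸ Subgroup.subset_normalClosure rfl))
      (key (x := u) (y := v) (h' ▸ Subgroup.subset_normalClosure rfl))) with h1 | h1
    · exact Or.inl (Multiplicative.toAdd.injective h1)
    · exact Or.inr (Multiplicative.toAdd.injective h1)
  rcases huv with rfl | rfl
  · exact Or.inl (IsConj.refl _)
  · exact Or.inr (IsConj.refl _)

theorem hasDetectingMagnusProperty_uLift_multiplicative_int :
    HasDetectingMagnusProperty (ULift (Multiplicative ℤ)) :=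
  isLimitGroup_uLift_multiplicative_int.hasDetectingMagnusProperty
    hasMagnusProperty_uLift_multiplicative_int

/-! ### The equivalence -/

theorem mainTheorem3 (C : Type u) [Group C] :
    List.TFAE [
      -- (i)
      ∃ (L : Type v) (_ : Group L), Nontrivial L ∧ IsLimitGroup L ∧ HasMagnusProperty L ∧
        HasMagnusProperty (L × C),
      -- (ii), for restricted direct products
      ∀ (I : Set ℕ) (L : I → Type w) [∀ i, Group (L i)],
        (∀ i, IsLimitGroup (L i)) → (∀ i, HasMagnusProperty (L i)) →
          HasMagnusProperty (RestrictedDirectProduct L × C),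
      -- (ii), for unrestricted direct products
      ∀ (I : Set ℕ) (L : I → Type w) [∀ i, Group (L i)],
        (∀ i, IsLimitGroup (L i)) → (∀ i, HasMagnusProperty (L i)) →
          HasMagnusProperty ((∀ i, L i) × C)] := by
  -- Each of the three statements is equivalent to `IsMagnusComplement C`.
  have h1 : IsMagnusComplement C → ∃ (L : Type v) (_ : Group L), Nontrivial L ∧ IsLimitGroup L ∧
      HasMagnusProperty L ∧ HasMagnusProperty (L × C) := fun hC =>
    ⟨ULift (Multiplicative ℤ), inferInstance, inferInstance, isLimitGroup_uLift_multiplicative_int,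
      hasMagnusProperty_uLift_multiplicative_int,
      hC.hasMagnusProperty_prod hasDetectingMagnusProperty_uLift_multiplicative_int⟩
  have h2 : (∃ (L : Type v) (_ : Group L), Nontrivial L ∧ IsLimitGroup L ∧
      HasMagnusProperty L ∧ HasMagnusProperty (L × C)) → IsMagnusComplement C := by
    rintro ⟨L, _, _, hL, hM, hLC⟩
    obtain ⟨l, hl⟩ := exists_ne (1 : L)
    exact .of_prod ((hL.hasDetectingMagnusProperty hM).not_isConj_inv hl) hLC
  tfae_have 1 → 2 := fun h I K _ hK hKM =>
    (h2 h).hasMagnusProperty_prod (.restrictedDirectProduct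
      fun i => (hK i).hasDetectingMagnusProperty (hKM i))
  tfae_have 1 → 3 := fun h I K _ hK hKM =>
    (h2 h).hasMagnusProperty_prod (.pi fun i => (hK i).hasDetectingMagnusProperty (hKM i))
  tfae_have 2 → 1 := by
    intro h
    have hZ := h {0} (fun _ => ULift (Multiplicative ℤ))
      (fun _ => isLimitGroup_uLift_multiplicative_int)
      (fun _ => hasMagnusProperty_uLift_multiplicative_int)
    have hX := HasDetectingMagnusProperty.restrictedDirectProduct
      fun _ : ({0} : Set ℕ) => hasDetectingMagnusProperty_uLift_multiplicative_int.{w}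
    let l : RestrictedDirectProduct fun _ : ({0} : Set ℕ) => ULift.{w} (Multiplicative ℤ) :=
      RestrictedProduct.mk (fun _ => ULift.up (Multiplicative.ofAdd 1)) (by simp)
    have hl : l ≠ 1 := fun hl => by
      have h0 := DFunLike.congr_fun hl ⟨0, rfl⟩
      have h0' : (Multiplicative.ofAdd (1 : ℤ)) = 1 := congrArg ULift.down h0
      exact absurd h0' (by decide)
    exact h1 (.of_prod (hX.not_isConj_inv hl) hZ)
  tfae_have 3 → 1 := by
    intro h
    have hZ := h {0} (fun _ => ULift (Multiplicative ℤ))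
      (fun _ => isLimitGroup_uLift_multiplicative_int)
      (fun _ => hasMagnusProperty_uLift_multiplicative_int)
    have hX := HasDetectingMagnusProperty.pi
      fun _ : ({0} : Set ℕ) => hasDetectingMagnusProperty_uLift_multiplicative_int.{w}
    obtain ⟨l, hl⟩ := exists_ne (1 : ({0} : Set ℕ) → ULift.{w} (Multiplicative ℤ))
    exact h1 (.of_prod (hX.not_isConj_inv hl) hZ)
  tfae_finish
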